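/- For integers $1\le m\le n$, let $\mathrm{PF}(m,n)$ be the set of parking functions with $m$ cars and $n$ spots: the sequences $(\pi_1,\dots,\pi_m)\in\{1,\dots,n\}^m$ such that, when cars $1,\dots,m$ arrive in this order and car $i$ parks in the first unoccupied spot that is $\ge \pi_i$, all $m$ cars are able to park. Let $l\ge 1$ and $p_1,\dots,p_l\ge 1$ be integers and let $0<c<1$. There are constants $K$ and $N$, depending only on $l$, $p_1,\dots,p_l$ and $c$, such that the following holds for all integers $n\ge N$ and $m\ge l$ with $m=cn$, or more generally with $|m-cn|<1$ (that is, $m=cn$ up to rounding to an integer). If $\pi$ is chosen uniformly at random from $\mathrm{PF}(m,n)$, then $$\mathbb{E}\Big(\prod_{i=1}^l \pi_i^{p_i}\Big)=\frac{n^{\sum_{i=1}^l p_i}}{\prod_{i=1}^l (p_i+1)}\left(1+\frac1n\left(\frac{\sum_{i=1}^l p_i+l}{2}-\frac{c\sum_{i=1}^l p_i}{1-c}\right)+\varepsilon\right)\quad\text{with } |\varepsilon|\le \frac{K}{n^2}.$$ -/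

import Mathlib

open MeasureTheory ProbabilityTheory

/-- Cars `0, …, m - 1` enter a one-way street with spots `Fin n` in this order, car `i` preferring
the spot `π i`. The assignment `τ` is the resulting parking outcome: every car `i` parks in the
first spot, at or after `π i`, that is not occupied by an earlier car. -/
def IsParkingOutcome {m n : ℕ} (π τ : Fin m → Fin n) : Prop :=
  ∀ i : Fin m, IsLeast {s : Fin n | π i ≤ s ∧ ∀ k : Fin m, k < i → τ k ≠ s} (τ i)

/-- The set `PF(m, n)` of (generalized) parking functions: the preference lists of `m` cars for
`n` spots under which all cars park. -/
def parkingFunctions (m n : ℕ) : Set (Fin m → Fin n) :=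
  {π | ∃ τ : Fin m → Fin n, IsParkingOutcome π τ}

/-- The mixed moment `E (∏_{i ≤ l} π_i ^ p_i)` for `π` uniform in `PF(m, n)`, where `l ≤ m`.
The spot `s : Fin n` has the number `s + 1 ∈ {1, …, n}`. -/
noncomputable def parkingMoment {l m : ℕ} (n : ℕ) (h : l ≤ m) (p : Fin l → ℕ) : ℝ :=
  ∫ π : Fin m → Fin n, ∏ i : Fin l, (((π (Fin.castLE h i) : ℕ) : ℝ) + 1) ^ p i
    ∂(uniformOn (parkingFunctions m n))

/-! A preference list parks iff no suffix of the street is preferred by more cars than it has spots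
(`mem_parkingFunctions_iff`). Hence the order of the cars is irrelevant, and the list splits into
the `l` cars `x` in the moment and the `M = m - l` others `f`, themselves a parking function.

For fixed `f`, the extension by `x` fails, to first order, when some car of `x` lies in a suffix
that `f` has already filled; every other correction needs two cars of `x` in one nearly full suffix
(`abs_sum_isParking_sub_le`). A Chernoff bound makes such suffixes short on average, with ratio `c *
exp (1 - c) < 1`, so these corrections are `O(1/n²)` relative to `n ^ l`
(`exists_sum_nearlyFullSum_le`).

The mean number of blocked spots follows exactly from the count of parking functions: it is `M / (n
+ 1 - M)`, within `O(1/n)` of `c / (1 - c)`. Blocked spots sit near the end of the street, so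
weighting them by `((y + 1) / n) ^ p` changes this mean only by `O(1/n)`. Faulhaber's formula gives
the unrestricted moments `1 / (p + 1) + 1 / (2 n) + O(1/n²)`. Combining these
(`hasExpansion_jointSum`) for the given exponents and for exponents `0`, which count the parking
functions, and dividing gives the expansion. -/

/-! ### Parking outcomes and the counting criterion -/

/-- The number of cars whose preference is at least `s`. -/
def suffixCount {ι : Type*} [Fintype ι] {n : ℕ} (f : ι → Fin n) (s : ℕ) : ℕ :=
  (Finset.univ.filter fun i => s ≤ (f i : ℕ)).card

/-- The counting criterion for parking functions: at most `n - s` cars prefer spots `≥ s`. -/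
def IsParking {ι : Type*} [Fintype ι] {n : ℕ} (f : ι → Fin n) : Prop :=
  ∀ s : ℕ, suffixCount f s ≤ n - s

theorem IsParkingOutcome.injective {m n : ℕ} {π τ : Fin m → Fin n} (h : IsParkingOutcome π τ) :
    Function.Injective τ := by
  intro i j hij
  rcases lt_trichotomy i j with hlt | heq | hgt
  · exact absurd hij ((h j).1.2 i hlt)
  · exact heq
  · exact absurd hij.symm ((h i).1.2 j hgt)

theorem card_filter_le_val (n s : ℕ) :
    (Finset.univ.filter fun t : Fin n => s ≤ (t : ℕ)).card = n - s := by
  have h := @Fin.card_filter_val_lt n s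
  have h2 := Finset.card_filter_add_card_filter_not (s := (Finset.univ : Finset (Fin n)))
    (fun t => (t : ℕ) < s)
  simp only [not_lt, Finset.card_univ, Fintype.card_fin] at h2
  omega

/-- Cars preferring a suffix park inside it, at distinct spots. -/
theorem IsParkingOutcome.isParking {m n : ℕ} {π τ : Fin m → Fin n} (h : IsParkingOutcome π τ) :
    IsParking π := by
  intro s
  rw [← card_filter_le_val n s]
  refine Finset.card_le_card_of_injOn τ ?_ h.injective.injOn
  intro i hi
  simp only [Finset.coe_filter, Finset.mem_univ, true_and, Set.mem_ofPred_eq] at hi ⊢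
  exact hi.trans (h i).1.1

/-- If all spots from `a` on are taken, then the cars preferring some suffix fill it completely. -/
theorem IsParkingOutcome.exists_suffixCount_eq {m n : ℕ} {π τ : Fin m → Fin n}
    (h : IsParkingOutcome π τ) (a : Fin n) (ha : ∀ s, a ≤ s → ∃ i, τ i = s) :
    ∃ k : ℕ, k ≤ a ∧ n - k ≤ suffixCount π k := by
  classical
  have hex : ∃ k : ℕ, ∀ s : Fin n, k ≤ (s : ℕ) → ∃ i, τ i = s := ⟨a, fun s hs => ha s hs⟩
  set k := Nat.find hex with hk
  have hkspec : ∀ s : Fin n, k ≤ (s : ℕ) → ∃ i, τ i = s := Nat.find_spec hex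
  have hka : k ≤ a := Nat.find_min' hex fun s hs => ha s hs
  refine ⟨k, hka, ?_⟩
  have : Nonempty (Fin m) := ⟨(ha a le_rfl).choose⟩
  choose! g hg using hkspec
  rw [← card_filter_le_val n k]
  refine Finset.card_le_card_of_injOn g ?_ ?_
  · intro s hs
    simp only [Finset.coe_filter, Finset.mem_univ, true_and, Set.mem_ofPred_eq] at hs ⊢
    by_contra hlt
    push Not at hlt
    have hk0 : 0 < k := by omega
    have hmin := Nat.find_min hex (m := k - 1) (by omega)
    push Not at hmin
    obtain ⟨t, ht1, ht2⟩ := hmin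
    have ht3 : ¬ k ≤ (t : ℕ) := fun hc => ht2 (g t) (hg t hc)
    -- By minimality of `k` the spot `t = k - 1` is free; a car with preference below `k` would have
    -- stopped there at the latest.
    have hle : τ (g s) ≤ t := by
      refine (h (g s)).2 ⟨?_, fun i _ => ht2 i⟩
      rw [Fin.le_def]; omega
    rw [hg s hs, Fin.le_def] at hle
    omega
  · intro s hs t ht hst
    simp only [Finset.coe_filter, Finset.mem_univ, true_and, Set.mem_ofPred_eq] at hs ht
    rw [← hg s hs, ← hg t ht, hst]

theorem suffixCount_succ {m n : ℕ} (π : Fin (m + 1) → Fin n) (s : ℕ) :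
    suffixCount π s = suffixCount (fun i : Fin m => π i.castSucc) s +
      if s ≤ (π (Fin.last m) : ℕ) then 1 else 0 := by
  simp only [suffixCount, Finset.card_filter, Fin.sum_univ_castSucc]

/-- Induction on the cars: were the last car to find no free spot, the earlier ones would already
fill a suffix containing its preference, and it would overload that suffix. -/
theorem IsParking.exists_outcome {m n : ℕ} {π : Fin m → Fin n} (h : IsParking π) :
    ∃ τ : Fin m → Fin n, IsParkingOutcome π τ := by
  classical
  induction m with
  | zero => exact ⟨fun i => i.elim0, fun i => i.elim0⟩
  | succ m ih =>
    obtain ⟨τ, hτ⟩ := ih (π := fun i => π i.castSucc) fun s =>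
      le_trans (by rw [suffixCount_succ π s]; omega) (h s)
    have hne : ∃ s : Fin n, π (Fin.last m) ≤ s ∧ ∀ i, τ i ≠ s := by
      by_contra hcon
      push Not at hcon
      obtain ⟨k, hk1, hk2⟩ := hτ.exists_suffixCount_eq _ hcon
      have h1 := h k
      rw [suffixCount_succ, if_pos hk1] at h1
      omega
    have hne' : (Finset.univ.filter fun s : Fin n =>
        π (Fin.last m) ≤ s ∧ ∀ i, τ i ≠ s).Nonempty := by
      obtain ⟨s, hs⟩ := hne
      exact ⟨s, by simpa using hs⟩
    have hmin := Finset.isLeast_min' _ hne'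
    set b := Finset.min' _ hne' with hb
    refine ⟨Fin.snoc τ b, fun i => ?_⟩
    refine Fin.lastCases ?_ (fun j => ?_) i
    · simp only [Fin.snoc_last]
      have hset : {s : Fin n | π (Fin.last m) ≤ s ∧ ∀ k : Fin (m + 1), k < Fin.last m →
          (Fin.snoc τ b : Fin (m + 1) → Fin n) k ≠ s} =
          ↑(Finset.univ.filter fun s : Fin n => π (Fin.last m) ≤ s ∧ ∀ i, τ i ≠ s) := by
        ext s
        simp only [Set.mem_ofPred_eq, Finset.coe_filter, Finset.mem_univ, true_and]
        refine and_congr_right fun _ => ⟨fun H j => ?_, fun H k hk => ?_⟩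
        · simpa using H j.castSucc (Fin.castSucc_lt_last j)
        · obtain ⟨j, rfl⟩ := Fin.exists_castSucc_eq.2 hk.ne
          simpa using H j
      rw [hset]
      exact hmin
    · simp only [Fin.snoc_castSucc]
      convert hτ j using 1
      ext s
      simp only [Set.mem_ofPred_eq]
      refine and_congr_right fun _ => ⟨fun H k hk => ?_, fun H k hk => ?_⟩
      · simpa using H k.castSucc (by simpa using hk)
      · obtain ⟨k, rfl⟩ := Fin.exists_castSucc_eq.2 (hk.trans (Fin.castSucc_lt_last j)).ne
        simpa using H k (by simpa using hk)

theorem mem_parkingFunctions_iff {m n : ℕ} (π : Fin m → Fin n) :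
    π ∈ parkingFunctions m n ↔ IsParking π :=
  ⟨fun ⟨_, h⟩ => h.isParking, fun h => h.exists_outcome⟩

/-! ### The number of parking functions -/

noncomputable instance {ι : Type*} [Fintype ι] {n : ℕ} :
    DecidablePred (IsParking : (ι → Fin n) → Prop) := Classical.decPred _

/-- The number of functions `ι → Fin n` satisfying the parking criterion. -/
noncomputable def parkingCard (ι : Type*) [Fintype ι] (n : ℕ) : ℕ :=
  Nat.card {f : ι → Fin n // IsParking f}

theorem parkingCard_eq_card_filter (ι : Type*) [Fintype ι] [DecidableEq ι] (n : ℕ) :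
    parkingCard ι n = (Finset.univ.filter fun f : ι → Fin n => IsParking f).card := by
  rw [parkingCard, Nat.card_eq_fintype_card, Fintype.card_subtype]

theorem suffixCount_comp_equiv {ι κ : Type*} [Fintype ι] [Fintype κ] {n : ℕ} (e : ι ≃ κ)
    (f : κ → Fin n) (s : ℕ) : suffixCount (f ∘ e) s = suffixCount f s := by
  simp only [suffixCount, Finset.card_filter, Function.comp]
  exact e.sum_comp fun i => if s ≤ (f i : ℕ) then 1 else 0

theorem isParking_comp_equiv {ι κ : Type*} [Fintype ι] [Fintype κ] {n : ℕ} (e : ι ≃ κ)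
    (f : κ → Fin n) : IsParking (f ∘ e) ↔ IsParking f := by
  simp only [IsParking, suffixCount_comp_equiv]

theorem parkingCard_congr {ι κ : Type*} [Fintype ι] [Fintype κ] (e : ι ≃ κ) (n : ℕ) :
    parkingCard ι n = parkingCard κ n := by
  refine Nat.card_congr ((e.arrowCongr (Equiv.refl (Fin n))).subtypeEquiv fun f => ?_)
  exact (isParking_comp_equiv e.symm f).symm

/-- Functions `ι → Fin (n + 1)` whose zero set is `S` are functions from the complement
to `Fin n`. -/
theorem card_parking_zero_set {ι : Type*} [Fintype ι] [DecidableEq ι] (n : ℕ)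
    (hι : Fintype.card ι ≤ n + 1) (S : Finset ι) :
    (Finset.univ.filter fun f : ι → Fin (n + 1) =>
      IsParking f ∧ (Finset.univ.filter fun i => f i ≠ 0) = S).card = parkingCard S n := by
  have key : ∀ (f : ι → Fin (n + 1)), (Finset.univ.filter fun i => f i ≠ 0) = S →
      ∀ (g : S → Fin n), (∀ i : S, f i = (g i).succ) → (IsParking f ↔ IsParking g) := by
    intro f hf g hg
    have hcount : ∀ s, suffixCount f (s + 1) = suffixCount g s := by
      intro s
      have h1 : (Finset.univ.filter fun i => s + 1 ≤ (f i : ℕ)) =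
          S.filter fun i => s + 1 ≤ (f i : ℕ) := by
        ext i
        simp only [Finset.mem_filter, Finset.mem_univ, true_and, ← hf]
        refine ⟨fun h => ⟨fun h0 => ?_, h⟩, fun h => h.2⟩
        rw [h0] at h; simp at h
      rw [suffixCount, h1, suffixCount, Finset.card_filter, Finset.card_filter, ← Finset.sum_coe_sort]
      simp [hg]
    constructor
    · intro H s
      rw [← hcount]
      exact (H (s + 1)).trans (by omega)
    · rintro H (_ | s)
      -- The condition at `s = 0` concerns all cars, including those preferring spot `0`, so it is
      -- not inherited from `g`.
      · exact (Finset.card_le_univ _).trans hι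
      · rw [hcount]
        exact (H s).trans (by omega)
  rw [parkingCard_eq_card_filter]
  refine Finset.card_bij'
    (i := fun (f : ι → Fin (n + 1))  hf => fun i : S => (f i : Fin (n + 1)).pred (by
      have := Finset.ext_iff.1 (Finset.mem_filter.1 hf).2.2 i
      exact (Finset.mem_filter.1 (this.2 i.2)).2))
    (j := fun (g : S → Fin n) _ => fun i => if h : i ∈ S then (g ⟨i, h⟩).succ else 0) ?_ ?_ ?_ ?_
  · intro f hf
    rw [Finset.mem_filter] at hf ⊢
    exact ⟨Finset.mem_univ _, (key f hf.2.2 _ fun i => by simp).1 hf.2.1⟩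
  · intro g hg
    rw [Finset.mem_filter] at hg ⊢
    have hS : (Finset.univ.filter fun i =>
        (if h : i ∈ S then (g ⟨i, h⟩).succ else 0 : Fin (n + 1)) ≠ 0) = S := by
      ext i
      by_cases h : i ∈ S <;> simp [h]
    exact ⟨Finset.mem_univ _, (key _ hS g fun i => by simp).2 hg.2, hS⟩
  · intro f hf
    funext i
    have := (Finset.mem_filter.1 hf).2.2
    by_cases h : i ∈ S
    · simp [h]
    · simp only [h, dite_false]
      rw [← this] at h
      simpa [eq_comm] using h
  · intro g hg
    funext i
    simp

/-- Classify by the set of cars not preferring spot `0`; deleting that spot leaves a parking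
function of those cars. -/
theorem parkingCard_succ {ι : Type*} [Fintype ι] (n : ℕ) (hι : Fintype.card ι ≤ n + 1) :
    parkingCard ι (n + 1) =
      ∑ i ∈ Finset.range (Fintype.card ι + 1), (Fintype.card ι).choose i * parkingCard (Fin i) n := by
  classical
  rw [parkingCard_eq_card_filter, Finset.card_eq_sum_card_fiberwise (t := Finset.univ.powerset)
    (f := fun f : ι → Fin (n + 1) => Finset.univ.filter fun i => f i ≠ 0)]
  · simp only [← Finset.card_univ (α := ι), ← smul_eq_mul]
    rw [← Finset.sum_powerset_apply_card fun i => parkingCard (Fin i) n]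
    refine Finset.sum_congr rfl fun S _ => ?_
    rw [Finset.filter_filter, card_parking_zero_set n hι S]
    exact parkingCard_congr (Fintype.equivFinOfCardEq (by simp)) n
  · intro f _
    simp

theorem sum_range_choose_mul_self_mul_pow {R : Type*} [CommRing R] (m : ℕ) (x : R) :
    ∑ i ∈ Finset.range (m + 2), ((m + 1).choose i : R) * i * x ^ i = (m + 1) * x * (x + 1) ^ m := by
  rw [Finset.sum_range_succ', add_pow, Finset.mul_sum]
  simp only [Nat.cast_zero, mul_zero, zero_mul, add_zero, one_pow, mul_one]
  refine Finset.sum_congr rfl fun i _ => ?_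
  have h : ((m : R) + 1) * m.choose i = (m + 1).choose (i + 1) * (i + 1) := by
    exact_mod_cast congrArg (Nat.cast (R := R)) (Nat.add_one_mul_choose_eq m i)
  push_cast
  rw [pow_succ]
  linear_combination (-(x ^ i * x)) * h

/-- The number of parking functions with `m` cars and `n` spots is `(n + 1 - m) (n + 1) ^ (m - 1)`. -/
theorem parkingCard_fin_mul (n m : ℕ) (hm : m ≤ n + 1) :
    (parkingCard (Fin m) n : ℝ) * (n + 1) = (n + 1 - m) * (n + 1) ^ m := by
  classical
  induction n generalizing m with
  | zero =>
    obtain rfl | rfl : m = 0 ∨ m = 1 := by omega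
    · have : parkingCard (Fin 0) 0 = 1 := by
        rw [parkingCard_eq_card_filter, Finset.filter_true_of_mem]
        · simp
        · intro f _ s
          simp [suffixCount]
      simp [this]
    · have : parkingCard (Fin 1) 0 = 0 := by
        rw [parkingCard_eq_card_filter, Finset.card_eq_zero, Finset.filter_eq_empty_iff]
        exact fun f => (f 0).elim0
      simp [this]
  | succ n ih =>
    rcases Nat.lt_or_ge (n + 1) m with hlt | hle
    · obtain rfl : m = n + 2 := by omega
      have : parkingCard (Fin (n + 2)) (n + 1) = 0 := by
        rw [parkingCard_eq_card_filter, Finset.card_eq_zero, Finset.filter_eq_empty_iff]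
        intro f _ hf
        have := hf 0
        simp [suffixCount] at this
      rw [this]
      push_cast
      ring
    · have hn : (n : ℝ) + 1 ≠ 0 := by positivity
      rw [parkingCard_succ n (by simpa using hle)]
      -- The factor `n + 1 - i` of the inductive formula splits the sum into a binomial expansion
      -- and its index-weighted variant.
      have hsum : (∑ i ∈ Finset.range (m + 1), (m.choose i : ℝ) * parkingCard (Fin i) n) * (n + 1) =
          (n + 1) * ∑ i ∈ Finset.range (m + 1), ((n : ℝ) + 1) ^ i * 1 ^ (m - i) * m.choose i -
          ∑ i ∈ Finset.range (m + 1), (m.choose i : ℝ) * i * (n + 1) ^ i := by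
        rw [Finset.sum_mul, Finset.mul_sum, ← Finset.sum_sub_distrib]
        refine Finset.sum_congr rfl fun i hi => ?_
        rw [mul_assoc, ih i (by have := Finset.mem_range.1 hi; omega)]
        ring
      rw [← add_pow] at hsum
      apply mul_right_cancel₀ hn
      simp only [Fintype.card_fin]
      push_cast
      rw [mul_right_comm, hsum]
      rcases m with _ | m
      · simp
        ring
      · rw [sum_range_choose_mul_self_mul_pow]
        push_cast
        ring

/-! ### Adding `l` cars to a parking function: blocked spots and second-order errors -/

section Estimates

variable {ι κ : Type*} [Fintype ι] [Fintype κ] {n : ℕ}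

theorem suffixCount_sumElim (x : ι → Fin n) (f : κ → Fin n) (s : ℕ) :
    suffixCount (Sum.elim x f) s = suffixCount x s + suffixCount f s := by
  simp only [suffixCount, Finset.card_filter, Fintype.sum_sum_type, Sum.elim_inl, Sum.elim_inr]
  congr

theorem isParking_of_sumElim {x : ι → Fin n} {f : κ → Fin n} (h : IsParking (Sum.elim x f)) :
    IsParking f := fun s => le_trans (by rw [suffixCount_sumElim]; omega) (h s)

/-- After the cars with preferences `f`, another car preferring `y` cannot park. -/
def Blocks (f : κ → Fin n) (y : Fin n) : Prop :=
  ∃ s : ℕ, s ≤ (y : ℕ) ∧ n - s ≤ suffixCount f s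

noncomputable instance (f : κ → Fin n) : DecidablePred (Blocks f) := Classical.decPred _

theorem suffixCount_pos_of_le {x : ι → Fin n} {s : ℕ} {i : ι} (h : s ≤ (x i : ℕ)) :
    0 < suffixCount x s :=
  Finset.card_pos.2 ⟨i, by simpa using h⟩

theorem Blocks.not_isParking {x : ι → Fin n} {f : κ → Fin n} {i : ι} (h : Blocks f (x i)) :
    ¬ IsParking (Sum.elim x f) := by
  obtain ⟨s, hs, hle⟩ := h
  intro hp
  have h1 := hp s
  have h2 := suffixCount_pos_of_le hs
  rw [suffixCount_sumElim] at h1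
  omega

/-- If `x` cannot be added to the parking function `f`, then one car of `x` alone cannot, or two
cars of `x` prefer a nearly full suffix. -/
theorem exists_blocks_or_of_not_isParking {x : ι → Fin n} {f : κ → Fin n} (hf : IsParking f)
    (h : ¬ IsParking (Sum.elim x f)) :
    (∃ i, Blocks f (x i)) ∨ ∃ i j, i ≠ j ∧ ∃ s, s < n ∧ s ≤ (x i : ℕ) ∧ s ≤ (x j : ℕ) ∧
      n - s < suffixCount f s + Fintype.card ι := by
  simp only [IsParking, not_forall, not_le, suffixCount_sumElim] at h
  obtain ⟨s, hs⟩ := h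
  have hfs := hf s
  have hpos : 0 < suffixCount x s := by omega
  obtain ⟨i, hi⟩ := Finset.card_pos.1 hpos
  have hi' : s ≤ (x i : ℕ) := by simpa using hi
  have hle : suffixCount x s ≤ Fintype.card ι := Finset.card_le_univ _
  rcases Nat.lt_or_ge 1 (suffixCount x s) with h1 | h1
  · obtain ⟨a, ha, b, hb, hab⟩ := Finset.one_lt_card.1 h1
    refine Or.inr ⟨a, b, hab, s, ?_, by simpa using ha, by simpa using hb, by omega⟩
    exact hi'.trans_lt (x i).2
  · exact Or.inl ⟨i, s, hi', by omega⟩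

/-- The longer of the two full suffixes contains both cars. -/
theorem exists_of_blocks_blocks {x : ι → Fin n} {f : κ → Fin n} {i j : ι}
    (hi : Blocks f (x i)) (hj : Blocks f (x j)) :
    ∃ s, s < n ∧ s ≤ (x i : ℕ) ∧ s ≤ (x j : ℕ) ∧ n - s < suffixCount f s + Fintype.card ι := by
  have hpos : 0 < Fintype.card ι := Fintype.card_pos_iff.2 ⟨i⟩
  obtain ⟨s, hs, hs'⟩ := hi
  obtain ⟨t, ht, ht'⟩ := hj
  have h1 := (x i).2
  rcases le_total s t with hst | hst
  · exact ⟨s, by omega, hs, by omega, by omega⟩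
  · exact ⟨t, by omega, by omega, ht, by omega⟩

/-- Truncated inclusion–exclusion. If no two cars share a nearly full suffix, failure means exactly
one blocked car and the left side vanishes; otherwise the left side is at most `card ι` and the
double sum is at least `1`. -/
theorem abs_not_isParking_sub_sum_blocks_le [DecidableEq ι] (x : ι → Fin n) {f : κ → Fin n}
    (hf : IsParking f) :
    |(if IsParking (Sum.elim x f) then (0 : ℝ) else 1) - ∑ i, if Blocks f (x i) then (1 : ℝ) else 0|
      ≤ Fintype.card ι * ∑ q ∈ (Finset.univ : Finset ι).offDiag, ∑ s ∈ Finset.range n,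
        if s ≤ (x q.1 : ℕ) ∧ s ≤ (x q.2 : ℕ) ∧ n - s < suffixCount f s + Fintype.card ι
        then (1 : ℝ) else 0 := by
  have hnn : ∀ q : ι × ι, ∀ s : ℕ, (0 : ℝ) ≤ if s ≤ (x q.1 : ℕ) ∧ s ≤ (x q.2 : ℕ) ∧
      n - s < suffixCount f s + Fintype.card ι then (1 : ℝ) else 0 := fun q s => by
    split_ifs <;> norm_num
  by_cases hE : ∃ i j, i ≠ j ∧ ∃ s, s < n ∧ s ≤ (x i : ℕ) ∧ s ≤ (x j : ℕ) ∧
      n - s < suffixCount f s + Fintype.card ι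
  · obtain ⟨i, j, hij, s, hsn, hs⟩ := hE
    have h1 : (1 : ℝ) ≤ ∑ q ∈ (Finset.univ : Finset ι).offDiag, ∑ s ∈ Finset.range n,
        if s ≤ (x q.1 : ℕ) ∧ s ≤ (x q.2 : ℕ) ∧ n - s < suffixCount f s + Fintype.card ι
        then (1 : ℝ) else 0 := by
      refine le_trans ?_ (Finset.single_le_sum
        (fun q _ => Finset.sum_nonneg fun s _ => hnn q s)
        (show (i, j) ∈ (Finset.univ : Finset ι).offDiag by simpa using hij))
      refine le_trans ?_ (Finset.single_le_sum (fun s _ => hnn (i, j) s) (Finset.mem_range.2 hsn))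
      rw [if_pos hs]
    have hcard : (1 : ℝ) ≤ Fintype.card ι := by
      exact_mod_cast Fintype.card_pos_iff.2 ⟨i⟩
    have h2 : ∑ i, (if Blocks f (x i) then (1 : ℝ) else 0) ≤ Fintype.card ι := by
      rw [Finset.sum_boole]
      exact_mod_cast Finset.card_le_univ _
    have h3 : 0 ≤ ∑ i, (if Blocks f (x i) then (1 : ℝ) else 0) :=
      Finset.sum_nonneg fun i _ => by split_ifs <;> norm_num
    refine le_trans ?_ (le_mul_of_one_le_right (by positivity) h1)
    rw [abs_le]
    split_ifs <;> constructor <;> linarith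
  · have hzero : (if IsParking (Sum.elim x f) then (0 : ℝ) else 1) -
        ∑ i, (if Blocks f (x i) then (1 : ℝ) else 0) = 0 := by
      by_cases hp : IsParking (Sum.elim x f)
      · rw [if_pos hp, Finset.sum_eq_zero fun i _ => if_neg fun hb => hb.not_isParking hp, sub_zero]
      · obtain ⟨i, hi⟩ := (exists_blocks_or_of_not_isParking hf hp).resolve_right hE
        rw [if_neg hp, Finset.sum_eq_single i, if_pos hi, sub_self]
        · intro j _ hji
          exact if_neg fun hj => hE ⟨j, i, hji, exists_of_blocks_blocks hj hi⟩
        · simp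
    rw [hzero, abs_zero]
    exact mul_nonneg (by positivity) (Finset.sum_nonneg fun q _ => Finset.sum_nonneg fun s _ => hnn q s)

theorem sum_pi_prod_mul {α : Type*} [Fintype α] [DecidableEq ι] (g : ι → α → ℝ) (i : ι) (h : α → ℝ) :
    ∑ x : ι → α, (∏ j, g j (x j)) * h (x i) =
      (∏ j ∈ Finset.univ.erase i, ∑ y, g j y) * ∑ y, g i y * h y := by
  have h1 := Finset.prod_univ_sum (fun _ : ι => (Finset.univ : Finset α))
    (fun j y => if j = i then g j y * h y else g j y)
  rw [Fintype.piFinset_univ, ← Finset.prod_erase_mul _ _ (Finset.mem_univ i)] at h1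
  simp only [if_true] at h1
  rw [Finset.prod_congr rfl fun j hj => by
    rw [Finset.sum_congr rfl fun y _ => if_neg (Finset.ne_of_mem_erase hj)]] at h1
  rw [h1]
  refine Finset.sum_congr rfl fun x _ => ?_
  rw [← Finset.prod_erase_mul _ _ (Finset.mem_univ i),
    ← Finset.prod_erase_mul _ (fun j => if j = i then g j (x j) * h (x j) else g j (x j))
      (Finset.mem_univ i), if_pos rfl, mul_assoc]
  congr 1
  exact Finset.prod_congr rfl fun j hj => (if_neg (Finset.ne_of_mem_erase hj)).symm

/-- The factor `card α ^ 2` on the left avoids the exponent `card ι - 2`. -/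
theorem sum_pi_mul_mul {α : Type*} [Fintype α] [DecidableEq ι] {i j : ι} (hij : i ≠ j) (h : α → ℝ) :
    (∑ x : ι → α, h (x i) * h (x j)) * (Fintype.card α : ℝ) ^ 2 =
      (∑ y, h y) ^ 2 * (Fintype.card α : ℝ) ^ Fintype.card ι := by
  have h1 := sum_pi_prod_mul (fun k y => if k = i then h y else 1) j h
  have hi : i ∈ (Finset.univ : Finset ι).erase j := by simp [hij]
  have h2 : ∀ x : ι → α, (∏ k, if k = i then h (x k) else 1) = h (x i) := fun x => by
    simp [Finset.prod_ite_eq']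
  simp only [h2, if_neg hij.symm, one_mul] at h1
  rw [h1, ← Finset.prod_erase_mul _ _ hi,
    Finset.prod_congr (g := fun _ => (Fintype.card α : ℝ)) rfl fun k hk => by
      rw [Finset.sum_congr rfl fun y _ => if_neg (Finset.ne_of_mem_erase hk)]
      simp]
  have hcard : Fintype.card ι = ((Finset.univ.erase j).erase i).card + 2 := by
    rw [← Finset.card_univ, ← Finset.card_erase_add_one (Finset.mem_univ j),
      ← Finset.card_erase_add_one hi]
  rw [Finset.prod_const, hcard, pow_add]
  simp only [if_true]
  ring

theorem sum_val_ge_indicator (n s : ℕ) (hs : s ≤ n) :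
    ∑ y : Fin n, (if s ≤ (y : ℕ) then (1 : ℝ) else 0) = n - s := by
  rw [Finset.sum_boole, card_filter_le_val, Nat.cast_sub hs]

/-- The sum of the squared lengths of the suffixes that are within `l` cars of being full. -/
noncomputable def nearlyFullSum (l : ℕ) (f : κ → Fin n) : ℝ :=
  ∑ s ∈ Finset.range n, if n - s < suffixCount f s + l then ((n : ℝ) - s) ^ 2 else 0

theorem nearlyFullSum_nonneg (l : ℕ) (f : κ → Fin n) : 0 ≤ nearlyFullSum l f :=
  Finset.sum_nonneg fun s _ => by split_ifs <;> positivity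

theorem sum_pair_nearlyFull [DecidableEq ι] (f : κ → Fin n) (l : ℕ) (hn : 0 < n) {i j : ι}
    (hij : i ≠ j) :
    ∑ x : ι → Fin n, ∑ s ∈ Finset.range n,
      (if s ≤ (x i : ℕ) ∧ s ≤ (x j : ℕ) ∧ n - s < suffixCount f s + l then (1 : ℝ) else 0) =
    (n : ℝ) ^ Fintype.card ι / n ^ 2 * nearlyFullSum l f := by
  have hn' : (n : ℝ) ≠ 0 := by positivity
  rw [Finset.sum_comm, nearlyFullSum, Finset.mul_sum]
  refine Finset.sum_congr rfl fun s hs => ?_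
  by_cases hc : n - s < suffixCount f s + l
  · have h1 := sum_pi_mul_mul (α := Fin n) hij fun y => if s ≤ (y : ℕ) then (1 : ℝ) else 0
    rw [sum_val_ge_indicator n s (Finset.mem_range.1 hs).le, Fintype.card_fin] at h1
    rw [if_pos hc, div_mul_eq_mul_div, eq_div_iff (by positivity), mul_comm ((n : ℝ) ^ _), ← h1]
    congr 1
    refine Finset.sum_congr rfl fun x _ => ?_
    simp only [hc, and_true]
    by_cases h1 : s ≤ (x i : ℕ) <;> by_cases h2 : s ≤ (x j : ℕ) <;> simp [h1, h2]
  · simp [hc]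

/-- The weighted number of ways to add `card ι` cars to a parking function, up to second order. -/
theorem abs_sum_isParking_sub_le [DecidableEq ι] {f : κ → Fin n} (hf : IsParking f) (hn : 0 < n)
    (g : ι → Fin n → ℝ) (hg0 : ∀ i y, 0 ≤ g i y) (hg1 : ∀ i y, g i y ≤ 1) :
    |(∑ x : ι → Fin n, if IsParking (Sum.elim x f) then ∏ i, g i (x i) else 0) -
      (∏ i, ∑ y, g i y - ∑ i, (∏ j ∈ Finset.univ.erase i, ∑ y, g j y) *
        ∑ y, if Blocks f y then g i y else 0)| ≤
      (Fintype.card ι : ℝ) ^ 3 * ((n : ℝ) ^ Fintype.card ι / n ^ 2 *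
        nearlyFullSum (Fintype.card ι) f) := by
  have e1 : ∏ i, ∑ y, g i y = ∑ x : ι → Fin n, ∏ i, g i (x i) := by
    rw [Finset.prod_univ_sum, Fintype.piFinset_univ]
  have e2 : ∑ i, (∏ j ∈ Finset.univ.erase i, ∑ y, g j y) * ∑ y, (if Blocks f y then g i y else 0) =
      ∑ x : ι → Fin n, (∏ i, g i (x i)) * ∑ i, (if Blocks f (x i) then (1 : ℝ) else 0) := by
    simp only [Finset.mul_sum (s := (Finset.univ : Finset ι))]
    rw [Finset.sum_comm]
    refine Finset.sum_congr rfl fun i _ => ?_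
    rw [sum_pi_prod_mul g i fun y => if Blocks f y then (1 : ℝ) else 0]
    simp only [mul_ite, mul_one, mul_zero]
  rw [e1, e2, ← Finset.sum_sub_distrib, ← Finset.sum_sub_distrib]
  refine (Finset.abs_sum_le_sum_abs _ _).trans ?_
  have hbound : ∀ x : ι → Fin n, |(if IsParking (Sum.elim x f) then ∏ i, g i (x i) else 0) -
      (∏ i, g i (x i) - (∏ i, g i (x i)) * ∑ i, if Blocks f (x i) then (1 : ℝ) else 0)| ≤
      Fintype.card ι * ∑ q ∈ (Finset.univ : Finset ι).offDiag, ∑ s ∈ Finset.range n,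
        if s ≤ (x q.1 : ℕ) ∧ s ≤ (x q.2 : ℕ) ∧ n - s < suffixCount f s + Fintype.card ι
        then (1 : ℝ) else 0 := by
    intro x
    refine le_trans ?_ (abs_not_isParking_sub_sum_blocks_le x hf)
    have hG0 : 0 ≤ ∏ i, g i (x i) := Finset.prod_nonneg fun i _ => hg0 _ _
    have hG1 : ∏ i, g i (x i) ≤ 1 := Finset.prod_le_one (fun i _ => hg0 _ _) fun i _ => hg1 _ _
    set G := ∏ i, g i (x i)
    set B := ∑ i, if Blocks f (x i) then (1 : ℝ) else 0
    -- The weight `G` lies in `[0, 1]`, so factoring it out reduces to the unweighted estimate.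
    have : (if IsParking (Sum.elim x f) then G else 0) - (G - G * B) =
        -(G * ((if IsParking (Sum.elim x f) then 0 else 1) - B)) := by
      split_ifs <;> ring
    rw [this, abs_neg, abs_mul, abs_of_nonneg hG0]
    exact mul_le_of_le_one_left (abs_nonneg _) hG1
  refine (Finset.sum_le_sum fun x _ => hbound x).trans ?_
  rw [← Finset.mul_sum, Finset.sum_comm, Finset.sum_congr rfl fun q hq =>
    sum_pair_nearlyFull f (Fintype.card ι) hn (Finset.mem_offDiag.1 hq).2.2, Finset.sum_const,
    nsmul_eq_mul, pow_succ' _ 2, mul_assoc]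
  refine mul_le_mul_of_nonneg_left (mul_le_mul_of_nonneg_right ?_ ?_) (by positivity)
  · rw [sq, Finset.offDiag_card, Finset.card_univ]
    exact_mod_cast Nat.sub_le _ _
  · exact mul_nonneg (by positivity) (nearlyFullSum_nonneg _ _)

theorem sum_isParking_sum_eq [DecidableEq ι] [DecidableEq κ] (F : (ι → Fin n) → ℝ) :
    ∑ h : ι ⊕ κ → Fin n, (if IsParking h then F (h ∘ Sum.inl) else 0) =
      ∑ f : κ → Fin n with IsParking f,
        ∑ x : ι → Fin n, if IsParking (Sum.elim x f) then F x else 0 := by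
  rw [← (Equiv.sumArrowEquivProdArrow ι κ (Fin n)).symm.sum_comp, Fintype.sum_prod_type_right,
    Finset.sum_filter]
  refine Finset.sum_congr rfl fun f _ => ?_
  split_ifs with hf
  · exact Finset.sum_congr rfl fun x _ => rfl
  · refine Finset.sum_eq_zero fun x _ => if_neg fun h => hf ?_
    exact isParking_of_sumElim (x := x) h

/-- A single added car admits no pairs, so the first-order description is exact. -/
theorem isParking_sumElim_const_iff {f : κ → Fin n} (hf : IsParking f) (x : Unit → Fin n) :
    IsParking (Sum.elim x f) ↔ ¬ Blocks f (x ()) := by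
  refine ⟨fun h hb => hb.not_isParking h, fun hb => ?_⟩
  by_contra h
  rcases exists_blocks_or_of_not_isParking hf h with ⟨i, hi⟩ | ⟨i, j, hij, _⟩
  · exact hb hi
  · exact hij rfl

/-- The mean number of spots that block another car, from the number of parking functions. -/
theorem sum_blocks_eq [DecidableEq κ] :
    ∑ f : κ → Fin n with IsParking f, ∑ y, (if Blocks f y then (1 : ℝ) else 0) =
      n * parkingCard κ n - parkingCard (Unit ⊕ κ) n := by
  classical
  have h := sum_isParking_sum_eq (ι := Unit) (κ := κ) (n := n) fun _ => 1
  rw [Finset.sum_boole, ← parkingCard_eq_card_filter] at h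
  rw [h, parkingCard_eq_card_filter, ← nsmul_eq_mul', ← Finset.sum_const, ← Finset.sum_sub_distrib]
  refine Finset.sum_congr rfl fun f hf => ?_
  rw [← (Equiv.funUnique Unit (Fin n)).symm.sum_comp]
  have hf' : IsParking f := (Finset.mem_filter.1 hf).2
  simp only [isParking_sumElim_const_iff hf']
  have : (n : ℝ) = ∑ _y : Fin n, (1 : ℝ) := by simp
  rw [this, ← Finset.sum_sub_distrib]
  refine Finset.sum_congr rfl fun y _ => ?_
  by_cases hb : Blocks f y <;> simp [hb]

/-- A blocked spot lies in a full suffix from some `s`, where the deficit is at most `a * (n - s) /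
n`; the suffix has `n - s` spots, whence the square in `nearlyFullSum`. -/
theorem sum_blocks_mul_le (f : κ → Fin n) {l : ℕ} (hl : 1 ≤ l) (g : Fin n → ℝ) (a : ℝ)
    (ha : 0 ≤ a) (hg : ∀ y, 1 - g y ≤ a * ((n : ℝ) - (y : ℕ)) / n) :
    ∑ y, (if Blocks f y then 1 - g y else 0) ≤ a / n * nearlyFullSum l f := by
  have h1 : ∀ y, (if Blocks f y then 1 - g y else 0) ≤ ∑ s ∈ Finset.range n,
      if s ≤ (y : ℕ) then (if n - s < suffixCount f s + l then a / n * ((n : ℝ) - s) else 0)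
      else 0 := by
    intro y
    have hnn : ∀ s ∈ Finset.range n, (0 : ℝ) ≤ if s ≤ (y : ℕ) then
        (if n - s < suffixCount f s + l then a / n * ((n : ℝ) - s) else 0) else 0 := by
      intro s hs
      have : (s : ℝ) ≤ n := by exact_mod_cast (Finset.mem_range.1 hs).le
      have h2 : 0 ≤ (n : ℝ) - s := by linarith
      split_ifs <;> positivity
    split_ifs with hb
    · obtain ⟨s, hs, hs'⟩ := hb
      refine le_trans ?_ (Finset.single_le_sum hnn (Finset.mem_range.2 (hs.trans_lt y.2)))
      rw [if_pos hs, if_pos (by omega)]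
      refine (hg y).trans ?_
      rw [mul_div_right_comm]
      have : (s : ℝ) ≤ (y : ℕ) := by exact_mod_cast hs
      gcongr
    · exact Finset.sum_nonneg hnn
  refine (Finset.sum_le_sum fun y _ => h1 y).trans ?_
  rw [Finset.sum_comm, nearlyFullSum, Finset.mul_sum]
  refine (Finset.sum_congr rfl fun s hs => ?_).le
  have h2 := sum_val_ge_indicator n s (Finset.mem_range.1 hs).le
  by_cases hc : n - s < suffixCount f s + l
  · have h3 : ∑ y : Fin n, (if s ≤ (y : ℕ) then a / n * ((n : ℝ) - s) else 0) =
        a / n * ((n : ℝ) - s) * ∑ y : Fin n, (if s ≤ (y : ℕ) then (1 : ℝ) else 0) := by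
      rw [Finset.mul_sum]
      simp
    simp only [hc, if_true]
    rw [h3, h2]
    ring
  · simp [hc]

/-! ### Chernoff bound for nearly full suffixes -/

/-- Exponential Markov inequality for independent uniform preferences, each car in the suffix
weighted by `c⁻¹`. The total weight is `(n + (c⁻¹ - 1) (n - s)) ^ card κ`, and `1 + t ≤ exp t` with
`card κ ≤ c n` produces `exp (1 - c) ^ (n - s)`. -/
theorem card_suffixCount_le [DecidableEq κ] {c : ℝ} (hc0 : 0 < c) (hc1 : c < 1) (hn : 0 < n)
    (hκ : (Fintype.card κ : ℝ) ≤ c * n) (l s : ℕ) (hs : s ≤ n) :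
    ∑ f : κ → Fin n, (if n - s < suffixCount f s + l then (1 : ℝ) else 0) ≤
      (n : ℝ) ^ Fintype.card κ * (c⁻¹ ^ l * (c * Real.exp (1 - c)) ^ (n - s)) := by
  have hc : 1 < c⁻¹ := (one_lt_inv₀ hc0).2 hc1
  have hn' : (0 : ℝ) < n := by exact_mod_cast hn
  have hks : ((n - s : ℕ) : ℝ) = n - s := Nat.cast_sub hs
  have h1 : ∀ f : κ → Fin n, (if n - s < suffixCount f s + l then (1 : ℝ) else 0) ≤
      c⁻¹ ^ l * c ^ (n - s) * ∏ i, if s ≤ (f i : ℕ) then c⁻¹ else 1 := by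
    intro f
    rw [Finset.prod_ite, Finset.prod_const, Finset.prod_const_one, mul_one]
    change _ ≤ c⁻¹ ^ l * c ^ (n - s) * c⁻¹ ^ suffixCount f s
    split_ifs with h
    · have : c⁻¹ ^ (n - s) ≤ c⁻¹ ^ (suffixCount f s + l) := pow_le_pow_right₀ hc.le h.le
      calc (1 : ℝ) = c⁻¹ ^ (n - s) * c ^ (n - s) := by
            rw [← mul_pow, inv_mul_cancel₀ hc0.ne', one_pow]
        _ ≤ c⁻¹ ^ (suffixCount f s + l) * c ^ (n - s) := by gcongr
        _ = _ := by rw [pow_add]; ring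
    · positivity
  have h2 : ∑ f : κ → Fin n, ∏ i, (if s ≤ (f i : ℕ) then c⁻¹ else 1) =
      ((n : ℝ) + (c⁻¹ - 1) * (n - s : ℕ)) ^ Fintype.card κ := by
    have := Finset.prod_univ_sum (fun _ : κ => (Finset.univ : Finset (Fin n)))
      (fun _ y => if s ≤ (y : ℕ) then c⁻¹ else 1)
    rw [Fintype.piFinset_univ] at this
    rw [← this, Finset.prod_const, Finset.card_univ]
    congr 1
    have h3 := sum_val_ge_indicator n s hs
    have h4 : ∀ y : Fin n, (if s ≤ (y : ℕ) then c⁻¹ else 1) =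
        1 + (c⁻¹ - 1) * if s ≤ (y : ℕ) then (1 : ℝ) else 0 := fun y => by split_ifs <;> ring
    rw [Finset.sum_congr rfl fun y _ => h4 y, Finset.sum_add_distrib, ← Finset.mul_sum, h3, hks]
    simp
  have h3 : ((n : ℝ) + (c⁻¹ - 1) * (n - s : ℕ)) ^ Fintype.card κ ≤
      (n : ℝ) ^ Fintype.card κ * Real.exp (1 - c) ^ (n - s) := by
    have e : (n : ℝ) + (c⁻¹ - 1) * (n - s : ℕ) = n * ((c⁻¹ - 1) * (n - s : ℕ) / n + 1) := by
      field_simp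
      ring
    have hnn : 0 ≤ (c⁻¹ - 1) * ((n - s : ℕ) : ℝ) / n :=
      div_nonneg (mul_nonneg (by linarith) (by positivity)) hn'.le
    rw [e, mul_pow]
    refine mul_le_mul_of_nonneg_left ?_ (by positivity)
    refine (pow_le_pow_left₀ (by linarith) (Real.add_one_le_exp _) _).trans ?_
    rw [← Real.exp_nat_mul, ← Real.exp_nat_mul, Real.exp_le_exp]
    refine (mul_le_mul_of_nonneg_right hκ hnn).trans (le_of_eq ?_)
    field_simp
  calc _ ≤ ∑ f : κ → Fin n, c⁻¹ ^ l * c ^ (n - s) * ∏ i, (if s ≤ (f i : ℕ) then c⁻¹ else 1) :=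
        Finset.sum_le_sum fun f _ => h1 f
    _ = c⁻¹ ^ l * c ^ (n - s) * ((n : ℝ) + (c⁻¹ - 1) * (n - s : ℕ)) ^ Fintype.card κ := by
        rw [← Finset.mul_sum, h2]
    _ ≤ c⁻¹ ^ l * c ^ (n - s) * ((n : ℝ) ^ Fintype.card κ * Real.exp (1 - c) ^ (n - s)) :=
        mul_le_mul_of_nonneg_left h3 (by positivity)
    _ = _ := by rw [mul_pow]; ring

end Estimates

/-- A positive proportion of all maps park, so bounds for sums over all maps become bounds for means
over parking functions. -/
theorem le_parkingCard {c : ℝ} {M n : ℕ} (hc0 : 0 < c) (hc1 : c < 1) (hM : (M : ℝ) ≤ c * n) :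
    (1 - c) * (n : ℝ) ^ M ≤ parkingCard (Fin M) n := by
  have hn0 : (0 : ℝ) ≤ n := by positivity
  have hMn : (M : ℝ) ≤ n := hM.trans (by nlinarith)
  have h := parkingCard_fin_mul n M (by exact_mod_cast hMn.trans (by linarith : (n : ℝ) ≤ n + 1))
  have hpos : (0 : ℝ) < n + 1 := by positivity
  refine le_of_mul_le_mul_right ?_ hpos
  rw [h]
  calc (1 - c) * (n : ℝ) ^ M * (n + 1) = ((1 - c) * (n + 1)) * (n : ℝ) ^ M := by ring
    _ ≤ ((n : ℝ) + 1 - M) * (n + 1) ^ M := by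
      refine mul_le_mul ?_ (by gcongr; linarith) (by positivity) (by linarith)
      nlinarith

theorem sum_nearlyFullSum_le {c : ℝ} (hc0 : 0 < c) (hc1 : c < 1) (l M n : ℕ) (hn : 0 < n)
    (hM : (M : ℝ) ≤ c * n) :
    ∑ f : Fin M → Fin n with IsParking f, nearlyFullSum l f ≤ (n : ℝ) ^ M * c⁻¹ ^ l *
      ∑ j ∈ Finset.range n, ((j + 1 : ℕ) : ℝ) ^ 2 * (c * Real.exp (1 - c)) ^ (j + 1) := by
  have h1 : ∑ f : Fin M → Fin n, nearlyFullSum l f =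
      ∑ s ∈ Finset.range n, ((n - s : ℕ) : ℝ) ^ 2 *
        ∑ f : Fin M → Fin n, (if n - s < suffixCount f s + l then (1 : ℝ) else 0) := by
    simp only [nearlyFullSum]
    rw [Finset.sum_comm]
    refine Finset.sum_congr rfl fun s hs => ?_
    rw [Nat.cast_sub (Finset.mem_range.1 hs).le, Finset.mul_sum]
    simp only [mul_ite, mul_one, mul_zero]
  have h2 : ∀ s ∈ Finset.range n,
      ∑ f : Fin M → Fin n, (if n - s < suffixCount f s + l then (1 : ℝ) else 0) ≤
        (n : ℝ) ^ M * (c⁻¹ ^ l * (c * Real.exp (1 - c)) ^ (n - s)) := fun s hs => by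
    have := card_suffixCount_le (κ := Fin M) hc0 hc1 hn (by simpa using hM) l s
      (Finset.mem_range.1 hs).le
    rwa [Fintype.card_fin] at this
  refine (Finset.sum_le_sum_of_subset_of_nonneg (Finset.filter_subset _ _)
    fun f _ _ => nearlyFullSum_nonneg l f).trans ?_
  rw [h1]
  refine (Finset.sum_le_sum fun s hs => mul_le_mul_of_nonneg_left (h2 s hs)
    (by positivity)).trans (le_of_eq ?_)
  rw [← Finset.sum_range_reflect, Finset.mul_sum]
  refine Finset.sum_congr rfl fun s hs => ?_
  have : n - (n - 1 - s) = s + 1 := by have := Finset.mem_range.1 hs; omega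
  rw [this]
  ring

/-- The mean of `nearlyFullSum` over parking functions is bounded. -/
theorem exists_sum_nearlyFullSum_le {c : ℝ} (hc0 : 0 < c) (hc1 : c < 1) (l : ℕ) :
    ∃ C : ℝ, 0 ≤ C ∧ ∀ M n : ℕ, 0 < n → (M : ℝ) ≤ c * n →
      ∑ f : Fin M → Fin n with IsParking f, nearlyFullSum l f ≤ C * parkingCard (Fin M) n := by
  have hr0 : 0 < c * Real.exp (1 - c) := by positivity
  -- This is `c < exp (c - 1)`, strict because `c ≠ 1`; it makes the suffix sums converge.
  have hr1 : c * Real.exp (1 - c) < 1 := by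
    have h1 : c - 1 + 1 < Real.exp (c - 1) := Real.add_one_lt_exp (by linarith)
    calc c * Real.exp (1 - c) < Real.exp (c - 1) * Real.exp (1 - c) := by gcongr; linarith
      _ = 1 := by rw [← Real.exp_add]; simp
  have hsum : Summable fun j : ℕ => ((j + 1 : ℕ) : ℝ) ^ 2 * (c * Real.exp (1 - c)) ^ (j + 1) :=
    (summable_nat_add_iff (f := fun j : ℕ => (j : ℝ) ^ 2 * (c * Real.exp (1 - c)) ^ j) 1).2
      (summable_pow_mul_geometric_of_norm_lt_one 2 (by rwa [Real.norm_of_nonneg hr0.le]))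
  obtain ⟨C0, hC0, hle⟩ : ∃ C0 : ℝ, 0 ≤ C0 ∧ ∀ n : ℕ,
      ∑ j ∈ Finset.range n, ((j + 1 : ℕ) : ℝ) ^ 2 * (c * Real.exp (1 - c)) ^ (j + 1) ≤ C0 :=
    ⟨_, tsum_nonneg fun j => by positivity,
      fun n => hsum.sum_le_tsum _ fun j _ => by positivity⟩
  have h1c : 0 < 1 - c := by linarith
  refine ⟨c⁻¹ ^ l * C0 / (1 - c), by positivity, fun M n hn hM => ?_⟩
  refine (sum_nearlyFullSum_le hc0 hc1 l M n hn hM).trans ?_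
  calc _ ≤ (n : ℝ) ^ M * c⁻¹ ^ l * C0 := mul_le_mul_of_nonneg_left (hle n) (by positivity)
    _ = c⁻¹ ^ l * C0 / (1 - c) * ((1 - c) * (n : ℝ) ^ M) := by field_simp
    _ ≤ _ := mul_le_mul_of_nonneg_left (le_parkingCard hc0 hc1 hM) (by positivity)

/-! ### Calculus of first-order expansions -/

section Expansion

open Asymptotics Filter Topology

variable {α : Type*} {F : Filter α} {ν : α → ℝ}

/-- First order expansion of `f` in the small parameter `ν`, with a second order error. -/
def HasExpansion (F : Filter α) (ν f : α → ℝ) (a b : ℝ) : Prop :=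
  (fun q => f q - (a + b * ν q)) =O[F] fun q => ν q ^ 2

theorem isBigO_one_of_tendsto_zero (hν : Tendsto ν F (𝓝 0)) : ν =O[F] fun _ => (1 : ℝ) :=
  hν.isBigO_one ℝ

theorem isBigO_pow_add_two (hν : Tendsto ν F (𝓝 0)) (i : ℕ) :
    (fun q => ν q ^ (i + 2)) =O[F] fun q => ν q ^ 2 := by
  have h := ((isBigO_one_of_tendsto_zero hν).pow i).mul (isBigO_refl (fun q => ν q ^ 2) F)
  simpa [pow_add] using h

theorem HasExpansion.tendsto {f : α → ℝ} {a b : ℝ} (hν : Tendsto ν F (𝓝 0))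
    (h : HasExpansion F ν f a b) : Tendsto f F (𝓝 a) := by
  have h1 : Tendsto (fun q => ν q ^ 2) F (𝓝 0) := by simpa using hν.pow 2
  have h2 := (h.trans_tendsto h1).add ((hν.const_mul b).const_add a)
  simpa using h2

theorem hasExpansion_const (a : ℝ) : HasExpansion F ν (fun _ => a) a 0 := by
  simp only [HasExpansion, zero_mul, add_zero, sub_self]
  exact isBigO_zero _ _

theorem HasExpansion.sub {f g : α → ℝ} {a b a' b' : ℝ} (hf : HasExpansion F ν f a b)
    (hg : HasExpansion F ν g a' b') :
    HasExpansion F ν (fun q => f q - g q) (a - a') (b - b') :=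
  (IsBigO.sub hf hg).congr_left fun q => by ring

theorem HasExpansion.add_isBigO {f g : α → ℝ} {a b : ℝ} (hf : HasExpansion F ν f a b)
    (hg : (fun q => g q - f q) =O[F] fun q => ν q ^ 2) : HasExpansion F ν g a b :=
  (IsBigO.add hf hg).congr_left fun q => by ring

theorem HasExpansion.mul {f g : α → ℝ} {a b a' b' : ℝ} (hν : Tendsto ν F (𝓝 0))
    (hf : HasExpansion F ν f a b) (hg : HasExpansion F ν g a' b') :
    HasExpansion F ν (fun q => f q * g q) (a * a') (a * b' + b * a') := by
  have h1 := IsBigO.mul hf ((hg.tendsto hν).isBigO_one ℝ)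
  have h2 := IsBigO.mul (((hν.const_mul b).const_add a).isBigO_one ℝ) hg
  have h3 := (isBigO_refl (fun q => ν q ^ 2) F).const_mul_left (b * b')
  simp only [mul_one, one_mul] at h1 h2
  exact ((h1.add h2).add h3).congr_left fun q => by ring

theorem HasExpansion.prod {ι : Type*} {f : ι → α → ℝ} {a b : ι → ℝ} (hν : Tendsto ν F (𝓝 0))
    (s : Finset ι) (ha : ∀ i, a i ≠ 0) (h : ∀ i, HasExpansion F ν (f i) (a i) (b i)) :
    HasExpansion F ν (fun q => ∏ i ∈ s, f i q) (∏ i ∈ s, a i)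
      ((∏ i ∈ s, a i) * ∑ i ∈ s, b i / a i) := by
  classical
  induction s using Finset.induction_on with
  | empty => simpa using hasExpansion_const (F := F) (ν := ν) 1
  | insert i s hi ih =>
    have h1 := (h i).mul hν ih
    simp only [Finset.prod_insert hi, Finset.sum_insert hi]
    convert h1 using 1
    have := ha i
    field_simp
    ring

theorem HasExpansion.sum {ι : Type*} {f : ι → α → ℝ} {a b : ι → ℝ}
    (s : Finset ι) (h : ∀ i, HasExpansion F ν (f i) (a i) (b i)) :
    HasExpansion F ν (fun q => ∑ i ∈ s, f i q) (∑ i ∈ s, a i) (∑ i ∈ s, b i) := by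
  refine (IsBigO.sum fun i (_ : i ∈ s) => h i).congr_left fun q => ?_
  simp only [Finset.sum_apply, Finset.sum_sub_distrib, Finset.sum_add_distrib, Finset.sum_mul]

theorem hasExpansion_param_mul {f : α → ℝ} {b : ℝ} (h : (fun q => f q - b) =O[F] ν) :
    HasExpansion F ν (fun q => ν q * f q) 0 b := by
  refine ((isBigO_refl ν F).mul h).congr (fun q => ?_) fun q => ?_ <;> ring

/-- Multiplying the proposed expansion by `g` recovers `f` to second order, and `1 / g` is bounded
because `g` tends to `1`. -/
theorem HasExpansion.div {f g : α → ℝ} {a b b' : ℝ} (hν : Tendsto ν F (𝓝 0))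
    (hf : HasExpansion F ν f a b) (hg : HasExpansion F ν g 1 b') :
    HasExpansion F ν (fun q => f q / g q) a (b - a * b') := by
  have hgt := hg.tendsto hν
  have h1 : HasExpansion F ν (fun q => a + (b - a * b') * ν q) a (b - a * b') := by
    simp only [HasExpansion, sub_self]
    exact isBigO_zero _ _
  have h2 := (hf.sub (hg.mul hν h1)).mul hν (f := fun q => f q - g q * (a + (b - a * b') * ν q))
    (hasExpansion_const 1)
  have h3 : (fun q => f q - g q * (a + (b - a * b') * ν q)) =O[F] fun q => ν q ^ 2 := by
    refine IsBigO.congr_left h2 fun q => ?_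
    ring
  have h4 := h3.mul ((hgt.inv₀ one_ne_zero).isBigO_one ℝ)
  simp only [mul_one] at h4
  refine h4.congr' ?_ EventuallyEq.rfl
  filter_upwards [hgt.eventually_ne one_ne_zero] with q hq
  field_simp

end Expansion

/-! ### Moments of a uniform point -/

section PowerMean

open Asymptotics Filter Topology

/-- The `p`-th moment of a uniform point of `{1 / n, …, n / n}`. -/
noncomputable def powMean (p n : ℕ) : ℝ :=
  (∑ y : Fin n, ((((y : ℕ) : ℝ) + 1) / n) ^ p) / n

/-- Faulhaber's formula for `1, …, n`, hence with `bernoulli'`, whose value at `1` is `+1 / 2`. -/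
theorem powMean_eq (p n : ℕ) (hn : 0 < n) :
    powMean p n = ∑ i ∈ Finset.range (p + 1),
      ((bernoulli' i * (p + 1).choose i / (p + 1) : ℚ) : ℝ) * ((n : ℝ)⁻¹) ^ i := by
  have hn' : (n : ℝ) ≠ 0 := by positivity
  have h := congrArg (fun x : ℚ => (x : ℝ)) (sum_Ico_pow n p)
  push_cast at h
  have h1 : ∑ y : Fin n, ((((y : ℕ) : ℝ) + 1) / n) ^ p =
      (∑ k ∈ Finset.Ico 1 (n + 1), (k : ℝ) ^ p) / (n : ℝ) ^ p := by
    rw [Finset.sum_Ico_eq_sum_range, Finset.sum_div, ← Fin.sum_univ_eq_sum_range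
      (fun i => (((1 + i : ℕ) : ℝ)) ^ p / (n : ℝ) ^ p)]
    refine Finset.sum_congr rfl fun y _ => ?_
    rw [div_pow]
    push_cast
    rw [add_comm]
  rw [powMean, h1, h, Finset.sum_div, Finset.sum_div]
  refine Finset.sum_congr rfl fun i hi => ?_
  have hi' : i ≤ p + 1 := (Finset.mem_range.1 hi).le
  have h2 : (n : ℝ) ^ (p + 1) = n ^ (p + 1 - i) * n ^ i := by rw [← pow_add]; congr 1; omega
  push_cast
  rw [div_div, ← pow_succ, h2, inv_pow]
  field_simp

theorem hasExpansion_powMean_zero :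
    HasExpansion atTop (fun n : ℕ => (n : ℝ)⁻¹) (powMean 0) 1 0 := by
  refine (hasExpansion_const (F := atTop) (ν := fun n : ℕ => (n : ℝ)⁻¹) 1).congr' ?_
    EventuallyEq.rfl
  filter_upwards [eventually_gt_atTop 0] with n hn
  rw [powMean_eq 0 n hn]
  simp

/-- The coefficient `1 / 2` is the Bernoulli term of index `1`, absent for `p = 0`; this is why that
case is separate. -/
theorem hasExpansion_powMean (p : ℕ) (hp : 1 ≤ p) :
    HasExpansion atTop (fun n : ℕ => (n : ℝ)⁻¹) (powMean p) (((p : ℝ) + 1)⁻¹) (1 / 2) := by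
  obtain ⟨p, rfl⟩ := Nat.exists_eq_add_of_le' hp
  have hν : Tendsto (fun n : ℕ => (n : ℝ)⁻¹) atTop (𝓝 0) := tendsto_inv_atTop_nhds_zero_nat
  have h := IsBigO.sum fun i (_ : i ∈ Finset.range p) => (isBigO_pow_add_two hν i).const_mul_left
    ((bernoulli' (i + 2) * (p + 1 + 1).choose (i + 2) / (((p + 1 : ℕ) : ℚ) + 1) : ℚ) : ℝ)
  refine h.congr' ?_ EventuallyEq.rfl
  filter_upwards [eventually_gt_atTop 0] with n hn
  rw [powMean_eq _ n hn, Finset.sum_range_succ', Finset.sum_range_succ']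
  have hp0 : (p : ℝ) + 1 + 1 ≠ 0 := by positivity
  simp only [Finset.sum_apply, zero_add, bernoulli'_zero, bernoulli'_one, Nat.choose_zero_right, Nat.choose_one_right,
    pow_zero, pow_one, add_assoc, one_add_one_eq_two]
  push_cast
  simp only [add_assoc, one_add_one_eq_two] at hp0 ⊢
  field_simp
  ring

end PowerMean

/-! ### Expansion of the joint sums and of the moment -/

section Moments

open Asymptotics Filter Topology

/-- The numbers `(M, n)` of remaining cars and of spots with `l + M = c n` up to rounding. -/
def roundingFilter (l : ℕ) (c : ℝ) : Filter (ℕ × ℕ) :=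
  comap Prod.snd atTop ⊓ 𝓟 {q | |((l + q.1 : ℕ) : ℝ) - c * q.2| < 1}

theorem tendsto_snd_roundingFilter (l : ℕ) (c : ℝ) :
    Tendsto Prod.snd (roundingFilter l c) atTop :=
  tendsto_comap.mono_left inf_le_left

theorem tendsto_inv_snd_roundingFilter (l : ℕ) (c : ℝ) :
    Tendsto (fun q : ℕ × ℕ => (q.2 : ℝ)⁻¹) (roundingFilter l c) (𝓝 0) :=
  tendsto_inv_atTop_nhds_zero_nat.comp (tendsto_snd_roundingFilter l c)

theorem eventually_roundingFilter (l : ℕ) (c : ℝ) :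
    ∀ᶠ q in roundingFilter l c, 0 < q.2 ∧ |((l + q.1 : ℕ) : ℝ) - c * q.2| < 1 :=
  ((tendsto_snd_roundingFilter l c).eventually (eventually_gt_atTop 0)).and
    (mem_inf_of_right (mem_principal_self _))

/-- Removing at least one car absorbs the rounding error. -/
theorem cast_le_of_abs_sub_lt {l M n : ℕ} {c : ℝ} (hl : 1 ≤ l)
    (h : |((l + M : ℕ) : ℝ) - c * n| < 1) : (M : ℝ) ≤ c * n := by
  have h1 := (abs_lt.1 h).2
  have h2 : (1 : ℝ) ≤ l := by exact_mod_cast hl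
  push_cast at h1
  linarith

/-- The sum of `∏ i, ((x i + 1) / n) ^ p i` over all pairs `(x, f)` that form a parking function. -/
noncomputable def jointSum {l : ℕ} (p : Fin l → ℕ) (M n : ℕ) : ℝ :=
  ∑ f : Fin M → Fin n with IsParking f, ∑ x : Fin l → Fin n,
    if IsParking (Sum.elim x f) then ∏ i, ((((x i : ℕ) : ℝ) + 1) / n) ^ p i else 0

/-- The mean over parking functions of the `p`-th moment of the set of blocked spots. -/
noncomputable def blockMean (p M n : ℕ) : ℝ :=
  (∑ f : Fin M → Fin n with IsParking f, ∑ y : Fin n,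
    if Blocks f y then ((((y : ℕ) : ℝ) + 1) / n) ^ p else 0) / parkingCard (Fin M) n

/-- The average of `abs_sum_isParking_sub_le` over all parking `f`, divided by `n ^ l`. -/
theorem abs_jointSum_sub_le {l : ℕ} (p : Fin l → ℕ) {M n : ℕ} (hn : 0 < n)
    (hG : 0 < (parkingCard (Fin M) n : ℝ)) :
    |jointSum p M n / ((n : ℝ) ^ l * parkingCard (Fin M) n) - (∏ i, powMean (p i) n -
      ∑ i, (∏ j ∈ Finset.univ.erase i, powMean (p j) n) *
        ((n : ℝ)⁻¹ * blockMean (p i) M n))| ≤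
      (l : ℝ) ^ 3 * ((∑ f : Fin M → Fin n with IsParking f, nearlyFullSum l f) /
        parkingCard (Fin M) n) * ((n : ℝ)⁻¹) ^ 2 := by
  have hn' : (0 : ℝ) < n := by exact_mod_cast hn
  set g : Fin l → Fin n → ℝ := fun i y => ((((y : ℕ) : ℝ) + 1) / n) ^ p i with hg
  have hy : ∀ y : Fin n, (((y : ℕ) : ℝ) + 1) / n ≤ 1 := fun y => by
    rw [div_le_one hn']
    exact_mod_cast y.2
  have h1 : |∑ f : Fin M → Fin n with IsParking f,
      ((∑ x : Fin l → Fin n, if IsParking (Sum.elim x f) then ∏ i, g i (x i) else 0) -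
      (∏ i, ∑ y, g i y - ∑ i, (∏ j ∈ Finset.univ.erase i, ∑ y, g j y) *
        ∑ y, if Blocks f y then g i y else 0))| ≤
      ∑ f : Fin M → Fin n with IsParking f,
        (l : ℝ) ^ 3 * ((n : ℝ) ^ l / n ^ 2 * nearlyFullSum l f) := by
    refine (Finset.abs_sum_le_sum_abs _ _).trans (Finset.sum_le_sum fun f hf => ?_)
    have := abs_sum_isParking_sub_le (Finset.mem_filter.1 hf).2 hn g
      (fun i y => by positivity) (fun i y => pow_le_one₀ (by positivity) (hy y))
    rwa [Fintype.card_fin] at this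
  have hA : ∀ i, ∑ y, g i y = n * powMean (p i) n := fun i => by
    rw [powMean, mul_div_cancel₀ _ hn'.ne']
  have hB : ∀ i, ∑ f : Fin M → Fin n with IsParking f, ∑ y, (if Blocks f y then g i y else 0) =
      parkingCard (Fin M) n * blockMean (p i) M n := fun i => by
    rw [blockMean, mul_div_cancel₀ _ hG.ne']
  have hcard : ∀ i : Fin l, (n : ℝ) ^ (Finset.univ.erase i).card = n ^ l * (n : ℝ)⁻¹ := fun i => by
    have : l = (Finset.univ.erase i).card + 1 := by
      rw [Finset.card_erase_add_one (Finset.mem_univ i)]; simp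
    conv_rhs => rw [this, pow_succ, mul_inv_cancel_right₀ hn'.ne']
  have h2 : ∑ f : Fin M → Fin n with IsParking f,
      ((∑ x : Fin l → Fin n, if IsParking (Sum.elim x f) then ∏ i, g i (x i) else 0) -
      (∏ i, ∑ y, g i y - ∑ i, (∏ j ∈ Finset.univ.erase i, ∑ y, g j y) *
        ∑ y, if Blocks f y then g i y else 0)) =
      ((n : ℝ) ^ l * parkingCard (Fin M) n) *
      (jointSum p M n / ((n : ℝ) ^ l * parkingCard (Fin M) n) - (∏ i, powMean (p i) n -
      ∑ i, (∏ j ∈ Finset.univ.erase i, powMean (p j) n) *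
        ((n : ℝ)⁻¹ * blockMean (p i) M n))) := by
    rw [Finset.sum_sub_distrib, Finset.sum_sub_distrib, Finset.sum_comm (t := Finset.univ (α := Fin l)),
      Finset.sum_const, nsmul_eq_mul, ← parkingCard_eq_card_filter]
    simp only [← Finset.mul_sum, hA, hB, Finset.prod_mul_distrib, Finset.prod_const, hcard,
      Finset.card_univ, Fintype.card_fin]
    rw [mul_sub, mul_div_cancel₀ _ (by positivity), mul_sub, Finset.mul_sum _ _ ((n : ℝ) ^ l * _)]
    refine congrArg₂ _ rfl (congrArg₂ _ (by ring) (Finset.sum_congr rfl fun i _ => by ring))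
  rw [h2, abs_mul, abs_of_pos (by positivity), ← Finset.mul_sum, ← Finset.mul_sum] at h1
  refine le_of_mul_le_mul_left (h1.trans (le_of_eq ?_))
    (by positivity : 0 < (n : ℝ) ^ l * parkingCard (Fin M) n)
  field_simp

/-- The unblocked spots number on average the ratio of the counts for `M + 1` and `M` cars. -/
theorem blockMean_zero {M n : ℕ} (hMn : M ≤ n) :
    blockMean 0 M n = M / (n + 1 - M) := by
  have hMn' : (M : ℝ) ≤ n := by exact_mod_cast hMn
  have h1 := parkingCard_fin_mul n M (by omega)
  have h2 := parkingCard_fin_mul n (M + 1) (by omega)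
  have hpos : (0 : ℝ) < n + 1 := by positivity
  have hpos' : (0 : ℝ) < n + 1 - M := by linarith
  have h3 : (parkingCard (Fin M) n : ℝ) = (n + 1 - M) * (n + 1) ^ M / (n + 1) := by
    rw [← h1, mul_div_cancel_right₀ _ hpos.ne']
  have h4 : (parkingCard (Fin (M + 1)) n : ℝ) = (n - M) * (n + 1) ^ M := by
    apply mul_right_cancel₀ hpos.ne'
    rw [h2]
    push_cast
    ring
  simp only [blockMean, pow_zero]
  rw [sum_blocks_eq, parkingCard_congr (Fintype.equivFinOfCardEq (by simp [add_comm]) :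
    Unit ⊕ Fin M ≃ Fin (M + 1)), h4, h3]
  field_simp
  ring

/-- Bernoulli's inequality bounds the deficit `1 - ((y + 1) / n) ^ p` linearly in the distance to
the end, as `sum_blocks_mul_le` requires. -/
theorem abs_blockMean_sub_le (p : ℕ) {l M n : ℕ} (hl : 1 ≤ l) (hn : 0 < n) :
    |blockMean p M n - blockMean 0 M n| ≤ p * ((∑ f : Fin M → Fin n with IsParking f,
      nearlyFullSum l f) / parkingCard (Fin M) n) * (n : ℝ)⁻¹ := by
  have hn' : (0 : ℝ) < n := by exact_mod_cast hn
  have hy : ∀ y : Fin n, (((y : ℕ) : ℝ) + 1) / n ≤ 1 := fun y => by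
    rw [div_le_one hn']
    exact_mod_cast y.2
  have h1 : ∀ y : Fin n, 1 - ((((y : ℕ) : ℝ) + 1) / n) ^ p ≤ p * ((n : ℝ) - (y : ℕ)) / n := by
    intro y
    have h0 : 0 ≤ (((y : ℕ) : ℝ) + 1) / n := by positivity
    have h2 := one_add_mul_le_pow (a := (((y : ℕ) : ℝ) + 1) / n - 1) (by linarith) p
    rw [add_sub_cancel] at h2
    have h3 : (p : ℝ) * ((n : ℝ) - (y : ℕ)) / n = p / n - p * ((((y : ℕ) : ℝ) + 1) / n - 1) := by
      field_simp
      ring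
    have h4 : (0 : ℝ) ≤ p / n := by positivity
    linarith
  have h2 : blockMean 0 M n - blockMean p M n =
      (∑ f : Fin M → Fin n with IsParking f, ∑ y : Fin n,
        if Blocks f y then 1 - ((((y : ℕ) : ℝ) + 1) / n) ^ p else 0) / parkingCard (Fin M) n := by
    rw [blockMean, blockMean, ← sub_div, ← Finset.sum_sub_distrib]
    congr 1
    refine Finset.sum_congr rfl fun f _ => ?_
    rw [← Finset.sum_sub_distrib]
    refine Finset.sum_congr rfl fun y _ => ?_
    split_ifs <;> simp
  rw [abs_sub_comm, h2, abs_of_nonneg]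
  · have h3 := Finset.sum_le_sum fun f (_ : f ∈ Finset.univ.filter
      fun f : Fin M → Fin n => IsParking f) => sum_blocks_mul_le f hl _ p (by positivity) h1
    refine (div_le_div_of_nonneg_right h3 (by positivity)).trans (le_of_eq ?_)
    rw [← Finset.mul_sum]
    ring
  · refine div_nonneg (Finset.sum_nonneg fun f _ => Finset.sum_nonneg fun y _ => ?_) (by positivity)
    have : ((((y : ℕ) : ℝ) + 1) / n) ^ p ≤ 1 := pow_le_one₀ (by positivity) (hy y)
    split_ifs <;> linarith

theorem isBigO_of_eventually_le {α : Type*} {F : Filter α} {f g : α → ℝ} (C : ℝ)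
    (h : ∀ᶠ q in F, |f q| ≤ C * g q) (hg : ∀ q, 0 ≤ g q) : f =O[F] g :=
  IsBigO.of_bound C (h.mono fun q hq => by
    rwa [Real.norm_eq_abs, Real.norm_of_nonneg (hg q)])

theorem isBigO_blockMean_sub {c : ℝ} (hc0 : 0 < c) (hc1 : c < 1) {l : ℕ} (hl : 1 ≤ l) (p : ℕ) :
    (fun q : ℕ × ℕ => blockMean p q.1 q.2 - c / (1 - c)) =O[roundingFilter l c]
      fun q => (q.2 : ℝ)⁻¹ := by
  obtain ⟨C, hC, hW⟩ := exists_sum_nearlyFullSum_le hc0 hc1 l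
  have h1c : 0 < 1 - c := by linarith
  have h1 : (fun q : ℕ × ℕ => blockMean p q.1 q.2 - blockMean 0 q.1 q.2) =O[roundingFilter l c]
      fun q => (q.2 : ℝ)⁻¹ := by
    refine isBigO_of_eventually_le (p * C) ?_ fun q => by positivity
    filter_upwards [eventually_roundingFilter l c] with q ⟨hn, hq⟩
    have hM := cast_le_of_abs_sub_lt hl hq
    refine (abs_blockMean_sub_le p hl hn).trans ?_
    gcongr
    exact div_le_of_le_mul₀ (by positivity) hC (hW _ _ hn hM)
  have h2 : (fun q : ℕ × ℕ => blockMean 0 q.1 q.2 - c / (1 - c)) =O[roundingFilter l c]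
      fun q => (q.2 : ℝ)⁻¹ := by
    refine isBigO_of_eventually_le ((l + 2) / ((1 - c) * (1 - c))) ?_ fun q => by positivity
    filter_upwards [eventually_roundingFilter l c] with q ⟨hn, hq⟩
    have hM := cast_le_of_abs_sub_lt hl hq
    have hn' : (0 : ℝ) < q.2 := by exact_mod_cast hn
    have hMn : (q.1 : ℝ) ≤ q.2 := hM.trans (by nlinarith)
    have hd : (1 - c) * q.2 ≤ (q.2 : ℝ) + 1 - q.1 := by linarith
    have hd0 : 0 < (1 - c) * (q.2 : ℝ) := by positivity
    rw [blockMean_zero (by exact_mod_cast hMn), div_sub_div _ _ (by linarith) h1c.ne', abs_div,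
      abs_of_pos (mul_pos (by linarith) h1c)]
    -- The numerator equals `(l + M - c n) - l - c`, bounded by `1 + l + c`.
    have hnum : |(q.1 : ℝ) * (1 - c) - (q.2 + 1 - q.1) * c| ≤ l + 2 := by
      have h3 := abs_lt.1 hq
      push_cast at h3
      have h4 : (0 : ℝ) ≤ l := by positivity
      rw [abs_le]
      constructor <;> nlinarith
    calc _ ≤ ((l : ℝ) + 2) / ((1 - c) * q.2 * (1 - c)) := by gcongr
      _ = _ := by field_simp
  exact (h1.add h2).congr_left fun q => by ring

/-- Expansion of the normalized joint sum. -/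
theorem hasExpansion_jointSum {c : ℝ} (hc0 : 0 < c) (hc1 : c < 1) {l : ℕ} (hl : 1 ≤ l)
    (p : Fin l → ℕ) (a b : Fin l → ℝ) (ha : ∀ i, a i ≠ 0)
    (h : ∀ i, HasExpansion atTop (fun n : ℕ => (n : ℝ)⁻¹) (powMean (p i)) (a i) (b i)) :
    HasExpansion (roundingFilter l c) (fun q => (q.2 : ℝ)⁻¹)
      (fun q => jointSum p q.1 q.2 / ((q.2 : ℝ) ^ l * parkingCard (Fin q.1) q.2))
      (∏ i, a i) ((∏ i, a i) * ∑ i, (b i - c / (1 - c)) / a i) := by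
  have hν := tendsto_inv_snd_roundingFilter l c
  have hA : ∀ i, HasExpansion (roundingFilter l c) (fun q => (q.2 : ℝ)⁻¹)
      (fun q => powMean (p i) q.2) (a i) (b i) := fun i =>
    IsBigO.comp_tendsto (h i) (tendsto_snd_roundingFilter l c)
  have hmain := (HasExpansion.prod hν Finset.univ ha hA).sub
    (HasExpansion.sum Finset.univ fun i => (HasExpansion.prod hν (Finset.univ.erase i) ha hA).mul hν
      (hasExpansion_param_mul (isBigO_blockMean_sub hc0 hc1 hl (p i))))
  obtain ⟨C, hC, hW⟩ := exists_sum_nearlyFullSum_le hc0 hc1 l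
  have h1 := hmain.add_isBigO (g := fun q : ℕ × ℕ =>
    jointSum p q.1 q.2 / ((q.2 : ℝ) ^ l * parkingCard (Fin q.1) q.2)) (by
      refine isBigO_of_eventually_le ((l : ℝ) ^ 3 * C) ?_ fun q => by positivity
      filter_upwards [eventually_roundingFilter l c] with q ⟨hn, hq⟩
      have hM := cast_le_of_abs_sub_lt hl hq
      have hn' : (0 : ℝ) < q.2 := by exact_mod_cast hn
      have hG : (0 : ℝ) < parkingCard (Fin q.1) q.2 :=
        lt_of_lt_of_le (mul_pos (by linarith) (by positivity)) (le_parkingCard hc0 hc1 hM)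
      refine (abs_jointSum_sub_le p hn hG).trans ?_
      gcongr
      exact div_le_of_le_mul₀ (by positivity) hC (hW _ _ hn hM))
  convert h1 using 1
  · simp
  · rw [Finset.mul_sum, Finset.mul_sum, ← Finset.sum_sub_distrib]
    refine Finset.sum_congr rfl fun i _ => ?_
    rw [← Finset.prod_erase_mul _ a (Finset.mem_univ i)]
    have := ha i
    field_simp
    ring

theorem integral_uniformOn_eq_sum_div {α : Type*} [Fintype α] [MeasurableSpace α]
    [MeasurableSingletonClass α] (s : Set α) [DecidablePred (· ∈ s)] (F : α → ℝ) :
    ∫ x, F x ∂(uniformOn s) =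
      (∑ x, if x ∈ s then F x else 0) / (Finset.univ.filter (· ∈ s)).card := by
  have hs : Measure.count s = ((Finset.univ.filter (· ∈ s)).card : ENNReal) := by
    rw [← Measure.count_apply_finset]
    congr 1
    ext x
    simp
  rw [uniformOn, ProbabilityTheory.cond, integral_smul_measure, ← integral_indicator s.toFinite.measurableSet,
    integral_fintype (Integrable.of_finite), hs]
  simp only [measureReal_def, Measure.count_singleton, ENNReal.toReal_one, one_mul,
    ENNReal.toReal_inv, ENNReal.toReal_natCast, smul_eq_mul, Set.indicator_apply]
  rw [div_eq_inv_mul]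

theorem sum_isParking_fin_add_eq {l M n : ℕ} (F : (Fin l → Fin n) → ℝ) :
    ∑ π : Fin (l + M) → Fin n, (if IsParking π then F (fun i => π (Fin.castAdd M i)) else 0) =
      ∑ f : Fin M → Fin n with IsParking f,
        ∑ x : Fin l → Fin n, if IsParking (Sum.elim x f) then F x else 0 := by
  rw [← sum_isParking_sum_eq, ← (finSumFinEquiv.arrowCongr (Equiv.refl (Fin n))).sum_comp]
  refine Finset.sum_congr rfl fun h _ => ?_
  have e : (finSumFinEquiv.arrowCongr (Equiv.refl (Fin n))) h =
    h ∘ (finSumFinEquiv (m := l) (n := M)).symm := rfl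
  simp only [e, isParking_comp_equiv]
  congr 2
  funext i
  simp

/-- The joint sum with zero exponents counts the parking functions, so the moment is a quotient of
two sums with the same kind of expansion. -/
theorem parkingMoment_eq {l M n : ℕ} (hn : 0 < n) (h : l ≤ l + M) (p : Fin l → ℕ)
    (hG : 0 < (parkingCard (Fin M) n : ℝ)) :
    parkingMoment n h p = (n : ℝ) ^ (∑ i, p i) *
      (jointSum p M n / ((n : ℝ) ^ l * parkingCard (Fin M) n) /
        (jointSum (fun _ : Fin l => 0) M n / ((n : ℝ) ^ l * parkingCard (Fin M) n))) := by
  classical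
  have hn' : (0 : ℝ) < n := by exact_mod_cast hn
  rw [parkingMoment, integral_uniformOn_eq_sum_div, div_div_div_cancel_right₀ (by positivity),
    ← Finset.sum_boole, ← mul_div_assoc]
  simp only [mem_parkingFunctions_iff]
  congr 1
  · have h1 := sum_isParking_fin_add_eq (M := M) fun x : Fin l → Fin n =>
      ∏ i, ((((x i : ℕ) : ℝ) + 1) / n) ^ p i
    rw [jointSum, ← h1, Finset.mul_sum]
    refine Finset.sum_congr rfl fun π _ => ?_
    simp only [div_pow, Finset.prod_div_distrib, Finset.prod_pow_eq_pow_sum, mul_ite, mul_zero]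
    rw [mul_div_cancel₀ _ (by positivity)]
    rfl
  · have h1 := sum_isParking_fin_add_eq (l := l) (M := M) (n := n) fun _ => 1
    rw [h1, jointSum]
    simp

end Moments

theorem mainTheorem3 (l : ℕ) (hl : 1 ≤ l) (p : Fin l → ℕ) (hp : ∀ i, 1 ≤ p i)
    (c : ℝ) (hc0 : 0 < c) (hc1 : c < 1) :
    ∃ (K : ℝ) (N : ℕ), ∀ m n : ℕ, N ≤ n → |(m : ℝ) - c * n| < 1 → ∀ h : l ≤ m,
      ∃ ε : ℝ, |ε| ≤ K / (n : ℝ) ^ 2 ∧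
        parkingMoment n h p =
          (n : ℝ) ^ (∑ i, p i) / (∏ i, ((p i : ℝ) + 1)) *
            (1 + 1 / (n : ℝ) *
                (((∑ i, (p i : ℝ)) + l) / 2 - c * (∑ i, (p i : ℝ)) / (1 - c)) + ε) := by
  have hν := tendsto_inv_snd_roundingFilter l c
  have h1 := hasExpansion_jointSum hc0 hc1 hl p (fun i => ((p i : ℝ) + 1)⁻¹) (fun _ => 1 / 2)
    (fun i => by positivity) fun i => hasExpansion_powMean (p i) (hp i)
  have h0 := hasExpansion_jointSum hc0 hc1 hl (fun _ => 0) (fun _ => 1) (fun _ => 0)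
    (fun i => one_ne_zero) fun i => hasExpansion_powMean_zero
  rw [Finset.prod_const_one] at h0
  have hP : (∏ i, ((p i : ℝ) + 1)) ≠ 0 := Finset.prod_ne_zero_iff.2 fun i _ => by positivity
  have h1c : 1 - c ≠ 0 := by linarith
  -- Rescaling turns the absolute error into the relative error `ε`. The denominator's first-order
  -- term `-l c / (1 - c)` cancels the `l` part of the numerator's `-(∑ p i + l) c / (1 - c)`.
  have h2 := (h1.div hν h0).const_mul_left (∏ i, ((p i : ℝ) + 1))
  obtain ⟨K, hK⟩ := h2.bound
  rw [roundingFilter, Filter.eventually_inf_principal, Filter.eventually_comap,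
    Filter.eventually_atTop] at hK
  obtain ⟨N, hN⟩ := hK
  refine ⟨K, max N 1, fun m n hn hm h => ?_⟩
  obtain ⟨M, rfl⟩ := Nat.exists_eq_add_of_le h
  have hn0 : 0 < n := lt_of_lt_of_le one_pos ((le_max_right _ _).trans hn)
  have hn' : (0 : ℝ) < n := by exact_mod_cast hn0
  have hG : (0 : ℝ) < parkingCard (Fin M) n := lt_of_lt_of_le
    (mul_pos (by linarith) (by positivity)) (le_parkingCard hc0 hc1 (cast_le_of_abs_sub_lt hl hm))
  have hb := hN n ((le_max_left _ _).trans hn) (M, n) rfl hm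
  rw [Real.norm_eq_abs, Real.norm_of_nonneg (by positivity), inv_pow, ← div_eq_mul_inv] at hb
  refine ⟨_, hb, ?_⟩
  rw [parkingMoment_eq hn0 h p hG]
  have hs1 : ∑ i, (1 / 2 - c / (1 - c)) / ((p i : ℝ) + 1)⁻¹ =
      (1 / 2 - c / (1 - c)) * (∑ i, (p i : ℝ) + l) := by
    simp only [div_inv_eq_mul]
    rw [← Finset.mul_sum, Finset.sum_add_distrib]
    simp
  simp only [hs1, Finset.prod_inv_distrib, Finset.sum_const, Finset.card_univ, Fintype.card_fin,
    nsmul_eq_mul, zero_sub, div_one, one_mul]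
  generalize jointSum p M n / ((n : ℝ) ^ l * parkingCard (Fin M) n) /
    (jointSum (fun _ => 0) M n / ((n : ℝ) ^ l * parkingCard (Fin M) n)) = R
  field_simp
  ring
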